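/- All graphs below are countably infinite, connected, of bounded degree (some $k\in\mathbb N$ bounds the number of neighbours of every vertex) and without self-loops. Let $p>1$ be a real number and let $G$ be such a graph with vertex set $V$, shortest path metric $d_G$, and a fixed vertex $o\in V$; $N_x$ denotes the set of neighbours of $x$. For $f\colon V\to\mathbb R$ put $I_p(f,V)=\sum_{x\in V}\sum_{y\in N_x}|f(y)-f(x)|^p$. Let $D_p(G)$ be the space of all $f\colon V\to\mathbb R$ with $I_p(f,V)<\infty$, with the norm $\|f\|_{D_p}=(I_p(f,V)+|f(o)|^p)^{1/p}$, and let $BD_p(G)$ be the algebra of all bounded functions in $D_p(G)$, with pointwise operations. Let $Sp(BD_p(G))$ be the set of nonzero homomorphisms of real algebras $\tau\colon BD_p(G)\to\mathbb C$, with the weak-$*$ topology (the topology of pointwise convergence on $BD_p(G)$), and let $i\colon V\to Sp(BD_p(G))$ be given by $i(x)(f)=f(x)$. Let $\mathbb RG$ be the set of finitely supported functions $V\to\mathbb R$ and let $B(\overline{\mathbb RG})_{D_p}$ be the set of bounded functions in the closure of $\mathbb RG$ in $D_p(G)$. The $p$-harmonic boundary of $G$ is $$\partial_p(G)=\{\tau\in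 Sp(BD_p(G))\setminus i(V) \mid \tau(f)=0\text{ for all } f\in B(\overline{\mathbb RG})_{D_p}\},$$ with the subspace topology. A rough isometry from $G$ to a graph $H$ with vertex set $W$ is a map $\phi\colon V\to W$ such that 1. there are constants $a\ge1$, $b\ge0$ with $\frac1a d_G(x_1,x_2)-b\le d_H(\phi(x_1),\phi(x_2))\le a\,d_G(x_1,x_2)+b$ for all $x_1,x_2\in V$; and 2. there is a constant $c>0$ such that for every $y\in W$ there is $x\in V$ with $d_H(\phi(x),y)<c$. **Theorem 2.6.** Let $p>1$ be a real number and let $G$ and $H$ be graphs. If there is a rough isometry from $G$ to $H$, then $\partial_p(G)$ is homeomorphic to $\partial_p(H)$ (for any choice of the fixed vertices of $G$ and $H$). -/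

import Mathlib

open scoped ENNReal

namespace PHarm

universe u v

/-- There is a natural number bounding the number of neighbours of every vertex. -/
def BoundedDegree {V : Type u} (G : SimpleGraph V) : Prop :=
  ∃ k : ℕ, ∀ x : V, (G.neighborSet x).encard ≤ (k : ℕ∞)

/-- A rough isometry between the vertex sets of two connected graphs, each with its
shortest path metric. -/
def IsRoughIsometry {V : Type u} {W : Type v} (G : SimpleGraph V) (H : SimpleGraph W)
    (φ : V → W) : Prop :=
  (∃ a b : ℝ, 1 ≤ a ∧ 0 ≤ b ∧ ∀ x₁ x₂ : V,
    1 / a * (G.dist x₁ x₂ : ℝ) - b ≤ (H.dist (φ x₁) (φ x₂) : ℝ) ∧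
      (H.dist (φ x₁) (φ x₂) : ℝ) ≤ a * (G.dist x₁ x₂ : ℝ) + b) ∧
  ∃ c : ℝ, 0 < c ∧ ∀ y : W, ∃ x : V, (H.dist (φ x) y : ℝ) < c

/-- The `p`-th power of the gradient, `|Df(x)|^p = ∑_{y ∈ N_x} |f y - f x|^p`,
as a value in `[0, ∞]`. -/
noncomputable def gradPow {V : Type u} (G : SimpleGraph V) (p : ℝ) (f : V → ℝ) (x : V) : ℝ≥0∞ :=
  ∑' y : G.neighborSet x, ‖f y - f x‖ₑ ^ p

/-- The `p`-Dirichlet sum `I_p(f, V) = ∑_{x ∈ V} |Df(x)|^p`, as a value in `[0, ∞]`. -/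
noncomputable def dirichletSum {V : Type u} (G : SimpleGraph V) (p : ℝ) (f : V → ℝ) : ℝ≥0∞ :=
  ∑' x : V, gradPow G p f x

/-- `f ∈ D_p(G)`. -/
def IsDirichletFinite {V : Type u} (G : SimpleGraph V) (p : ℝ) (f : V → ℝ) : Prop :=
  dirichletSum G p f < ∞

/-- `f ∈ ℓ^∞(G)`. -/
def IsBoundedFun {V : Type u} (f : V → ℝ) : Prop :=
  ∃ M : ℝ, ∀ x : V, |f x| ≤ M

/-- The norm `(I_p(f, V) + |f(o)|^p)^(1/p)` of `D_p(G)`, as a value in `[0, ∞]`. -/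
noncomputable def dirichletNorm {V : Type u} (G : SimpleGraph V) (p : ℝ) (o : V)
    (f : V → ℝ) : ℝ≥0∞ :=
  (dirichletSum G p f + ‖f o‖ₑ ^ p) ^ (1 / p)

/-- `f` lies in the closure, in `D_p(G)` with the norm `dirichletNorm G p o`, of the set of
finitely supported functions. -/
def InClosureFinSupp {V : Type u} (G : SimpleGraph V) (p : ℝ) (o : V) (f : V → ℝ) : Prop :=
  IsDirichletFinite G p f ∧
    ∀ ε : ℝ≥0∞, 0 < ε → ∃ g : V → ℝ, (Function.support g).Finite ∧
      dirichletNorm G p o (f - g) < ε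

theorem dirichletSum_lt_top_of_le {V : Type u} {G : SimpleGraph V} {p : ℝ} (hp : 1 < p)
    {f g h : V → ℝ} (A B : ℝ) (hf : IsDirichletFinite G p f) (hg : IsDirichletFinite G p g)
    (hle : ∀ x y, |h y - h x| ≤ A * |f y - f x| + B * |g y - g x|) :
    IsDirichletFinite G p h := by
  have hp0 : 0 ≤ p := by linarith
  have hC : (2 : ℝ≥0∞) ^ (p - 1) ≠ ∞ :=
    ENNReal.rpow_ne_top_of_nonneg (by linarith) (by simp)
  have key : ∀ x y, ‖h y - h x‖ₑ ^ p ≤ 2 ^ (p - 1) * (‖A‖ₑ ^ p * ‖f y - f x‖ₑ ^ p) +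
      2 ^ (p - 1) * (‖B‖ₑ ^ p * ‖g y - g x‖ₑ ^ p) := by
    intro x y
    have h1 : ‖h y - h x‖ₑ ≤ ‖A‖ₑ * ‖f y - f x‖ₑ + ‖B‖ₑ * ‖g y - g x‖ₑ := by
      rw [← enorm_mul, ← enorm_mul]
      simp only [← ofReal_norm]
      rw [← ENNReal.ofReal_add (norm_nonneg _) (norm_nonneg _)]
      apply ENNReal.ofReal_le_ofReal
      simp only [norm_mul, Real.norm_eq_abs]
      refine (hle x y).trans ?_
      gcongr <;> exact le_abs_self _
    calc ‖h y - h x‖ₑ ^ p ≤ (‖A‖ₑ * ‖f y - f x‖ₑ + ‖B‖ₑ * ‖g y - g x‖ₑ) ^ p := by gcongr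
      _ ≤ 2 ^ (p - 1) * ((‖A‖ₑ * ‖f y - f x‖ₑ) ^ p + (‖B‖ₑ * ‖g y - g x‖ₑ) ^ p) :=
        ENNReal.rpow_add_le_mul_rpow_add_rpow _ _ hp.le
      _ = _ := by
        rw [ENNReal.mul_rpow_of_nonneg _ _ hp0, ENNReal.mul_rpow_of_nonneg _ _ hp0, mul_add]
  have hsum : dirichletSum G p h ≤ 2 ^ (p - 1) * (‖A‖ₑ ^ p * dirichletSum G p f) +
      2 ^ (p - 1) * (‖B‖ₑ ^ p * dirichletSum G p g) := by
    simp only [dirichletSum, gradPow, ← ENNReal.tsum_mul_left, ← ENNReal.tsum_add]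
    exact ENNReal.tsum_le_tsum fun x => ENNReal.tsum_le_tsum fun y => key x y
  refine hsum.trans_lt (ENNReal.add_lt_top.2 ⟨?_, ?_⟩)
  · exact ENNReal.mul_lt_top hC.lt_top (ENNReal.mul_lt_top
      (ENNReal.rpow_lt_top_of_nonneg hp0 (by simp)) hf)
  · exact ENNReal.mul_lt_top hC.lt_top (ENNReal.mul_lt_top
      (ENNReal.rpow_lt_top_of_nonneg hp0 (by simp)) hg)

/-- The algebra `BD_p(G)` of bounded real functions with finite `p`-Dirichlet sum, with
pointwise operations. -/
def BD {V : Type u} (G : SimpleGraph V) (p : ℝ) (hp : 1 < p) : Subalgebra ℝ (V → ℝ) where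
  carrier := {f | IsDirichletFinite G p f ∧ IsBoundedFun f}
  add_mem' := by
    rintro f g ⟨hf, M, hM⟩ ⟨hg, N, hN⟩
    refine ⟨dirichletSum_lt_top_of_le hp 1 1 hf hg fun x y => ?_, M + N, fun x => ?_⟩
    · have : (f + g) y - (f + g) x = (f y - f x) + (g y - g x) := by
        simp only [Pi.add_apply]; ring
      rw [this, one_mul, one_mul]
      exact abs_add_le _ _
    · exact (abs_add_le _ _).trans (add_le_add (hM x) (hN x))
  mul_mem' := by
    rintro f g ⟨hf, M, hM⟩ ⟨hg, N, hN⟩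
    refine ⟨dirichletSum_lt_top_of_le hp N M hf hg fun x y => ?_, M * N, fun x => ?_⟩
    · have : (f * g) y - (f * g) x = g y * (f y - f x) + f x * (g y - g x) := by
        simp only [Pi.mul_apply]; ring
      rw [this]
      refine (abs_add_le _ _).trans ?_
      rw [abs_mul, abs_mul]
      exact add_le_add (mul_le_mul_of_nonneg_right (hN y) (abs_nonneg _))
        (mul_le_mul_of_nonneg_right (hM x) (abs_nonneg _))
    · rw [Pi.mul_apply, abs_mul]
      exact mul_le_mul (hM x) (hN x) (abs_nonneg _) ((abs_nonneg _).trans (hM x))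
  algebraMap_mem' := by
    intro r
    refine ⟨?_, |r|, fun x => le_of_eq rfl⟩
    have : dirichletSum G p (algebraMap ℝ (V → ℝ) r) = 0 := by
      simp [dirichletSum, gradPow, Pi.algebraMap_apply,
        ENNReal.zero_rpow_of_pos (zero_lt_one.trans hp)]
    simp only [IsDirichletFinite, this, ENNReal.zero_lt_top]

/-- The spectrum `Sp(BD_p(G))`: the nonzero homomorphisms of real algebras from `BD_p(G)`
to the complex numbers. -/
def Sp {V : Type u} (G : SimpleGraph V) (p : ℝ) (hp : 1 < p) : Type u :=
  {τ : BD G p hp →ₙₐ[ℝ] ℂ // τ ≠ 0}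

/-- The weak-* topology on the spectrum, that is, the topology of pointwise convergence
on `BD_p(G)`. -/
noncomputable instance instTopologicalSpaceSp {V : Type u} (G : SimpleGraph V) (p : ℝ) (hp : 1 < p) :
    TopologicalSpace (Sp G p hp) :=
  TopologicalSpace.induced (fun τ (f : BD G p hp) => τ.1 f) inferInstance

/-- The evaluation character `i(x) : f ↦ f(x)` of a vertex `x`. -/
noncomputable def evalChar {V : Type u} (G : SimpleGraph V) (p : ℝ) (hp : 1 < p) (x : V) : Sp G p hp :=
  ⟨{ toFun := fun f => ((f.1 x : ℝ) : ℂ)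
     map_smul' := by intro r f; simp
     map_zero' := by simp
     map_add' := by intro f g; simp
     map_mul' := by intro f g; simp }, by
    intro h
    have h1 := DFunLike.congr_fun h (1 : BD G p hp)
    simp at h1⟩

/-- The `p`-Royden boundary `R_p(G) = Sp(BD_p(G)) \ i(V)`. -/
def roydenBoundary {V : Type u} (G : SimpleGraph V) (p : ℝ) (hp : 1 < p) : Set (Sp G p hp) :=
  (Set.range (evalChar G p hp))ᶜ

/-- The `p`-harmonic boundary `∂_p(G)`: the points of the `p`-Royden boundary at which the
Gelfand transforms of all bounded functions in the `D_p(G)`-closure of the finitely supported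
functions vanish. The vertex `o` is the base point of the norm of `D_p(G)`. As a subtype it
carries the subspace topology. -/
def harmonicBoundary {V : Type u} (G : SimpleGraph V) (p : ℝ) (hp : 1 < p) (o : V) :
    Set (Sp G p hp) :=
  {τ | τ ∈ roydenBoundary G p hp ∧
    ∀ f : BD G p hp, InClosureFinSupp G p o f.1 → τ.1 f = 0}

end PHarm

/-! A rough isometry `φ` has a rough inverse `ψ`, and characters push forward along both by
dualising `f ↦ f ∘ φ` and `f ↦ f ∘ ψ`. These maps need not be inverse on the whole spectrum, but `f
∘ ψ ∘ φ - f` is a difference across bounded distances, hence lies in `ℓ^p`, hence in the closure of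
the finitely supported functions. Boundary characters vanish there, so on the boundaries the two
maps are mutually inverse (`spMap_spMap`).

The estimate behind everything: `|f y - f x|^p` is at most a constant times the gradient mass near
`x`, when `y` is within distance `n` (`enorm_sub_rpow_le_iterate`). Bounded degree makes the sum of
these local masses over all `x` a bounded multiple of the Dirichlet sum (`tsum_iterate_ballSum_le`).
Hence composition preserves Dirichlet finiteness and the closure. -/

namespace PHarm

universe u v

variable {V : Type u} {W : Type v}

/-! ### Local sums in graphs of bounded degree -/

section NeighbourSum

/-- The sum of `F` over the closed unit ball around `x`. -/
noncomputable def ballSum (G : SimpleGraph V) (F : V → ℝ≥0∞) (x : V) : ℝ≥0∞ :=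
  F x + ∑' y : G.neighborSet x, F y

theorem le_ballSum (G : SimpleGraph V) (F : V → ℝ≥0∞) (x : V) : F x ≤ ballSum G F x :=
  le_self_add

theorem le_tsum_neighborSet {G : SimpleGraph V} (F : V → ℝ≥0∞) {x y : V} (h : G.Adj x y) :
    F y ≤ ∑' z : G.neighborSet x, F z :=
  ENNReal.le_tsum (f := fun z : G.neighborSet x => F z) ⟨y, h⟩

theorem tsum_neighborSet_const_le {G : SimpleGraph V} {k : ℕ}
    (hk : ∀ x : V, (G.neighborSet x).encard ≤ (k : ℕ∞)) (c : ℝ≥0∞) (x : V) :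
    ∑' _ : G.neighborSet x, c ≤ k * c := by
  rw [ENNReal.tsum_set_const]
  gcongr
  exact_mod_cast ENat.toENNReal_le.2 (hk x)

/-- Adjacency is symmetric, so after exchanging the sums each `F y` is counted once per neighbour of
`y`. -/
theorem tsum_tsum_neighborSet_le {G : SimpleGraph V} {k : ℕ}
    (hk : ∀ x : V, (G.neighborSet x).encard ≤ (k : ℕ∞)) (F : V → ℝ≥0∞) :
    ∑' x, ∑' y : G.neighborSet x, F y ≤ k * ∑' x, F x := by
  classical
  have h1 : ∀ x, ∑' y : G.neighborSet x, F y = ∑' y, if G.Adj x y then F y else 0 := fun x => by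
    rw [tsum_subtype]
    rfl
  have h2 : ∀ y, ∑' x, (if G.Adj x y then F y else 0) = ∑' _ : G.neighborSet y, F y := fun y => by
    rw [tsum_subtype (G.neighborSet y) (fun _ => F y)]
    refine tsum_congr fun x => ?_
    simp only [Set.indicator, SimpleGraph.mem_neighborSet, G.adj_comm x y]
  simp only [h1]
  rw [ENNReal.tsum_comm, ← ENNReal.tsum_mul_left]
  refine ENNReal.tsum_le_tsum fun y => ?_
  rw [h2]
  exact tsum_neighborSet_const_le hk _ _

theorem tsum_ballSum_le {G : SimpleGraph V} {k : ℕ}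
    (hk : ∀ x : V, (G.neighborSet x).encard ≤ (k : ℕ∞)) (F : V → ℝ≥0∞) :
    ∑' x, ballSum G F x ≤ (1 + k) * ∑' x, F x := by
  simp only [ballSum]
  rw [ENNReal.tsum_add, add_mul, one_mul]
  gcongr
  exact tsum_tsum_neighborSet_le hk F

/-- The iterate weights each vertex by the number of `n`-step walks, pauses allowed, from `x`. It
dominates `F` on the ball of radius `n`, and its total is bounded without counting balls. -/
theorem tsum_iterate_ballSum_le {G : SimpleGraph V} {k : ℕ}
    (hk : ∀ x : V, (G.neighborSet x).encard ≤ (k : ℕ∞)) (n : ℕ) (F : V → ℝ≥0∞) :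
    ∑' x, (ballSum G)^[n] F x ≤ (1 + k) ^ n * ∑' x, F x := by
  induction n with
  | zero => simp
  | succ n ih =>
    rw [Function.iterate_succ_apply', pow_succ', mul_assoc]
    exact (tsum_ballSum_le hk _).trans (by gcongr)

theorem iterate_ballSum_mono (G : SimpleGraph V) (F : V → ℝ≥0∞) (x : V) :
    Monotone fun n => (ballSum G)^[n] F x := by
  refine monotone_nat_of_le_succ fun n => ?_
  rw [Function.iterate_succ_apply']
  exact le_ballSum _ _ _

theorem add_le_iterate_ballSum_succ {G : SimpleGraph V} (F : V → ℝ≥0∞) (n : ℕ) {x y : V}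
    (h : G.Adj x y) : F x + (ballSum G)^[n] F y ≤ (ballSum G)^[n + 1] F x := by
  rw [Function.iterate_succ_apply']
  exact add_le_add (iterate_ballSum_mono G F x n.zero_le) (le_tsum_neighborSet _ h)

theorem le_iterate_ballSum_of_walk {G : SimpleGraph V} (F : V → ℝ≥0∞) {x y : V}
    (w : G.Walk x y) : F y ≤ (ballSum G)^[w.length] F x := by
  induction w with
  | nil => simp
  | cons h w ih =>
    exact (ih.trans le_add_self).trans (add_le_iterate_ballSum_succ F _ h)

theorem le_iterate_ballSum {G : SimpleGraph V} (hG : G.Connected) (F : V → ℝ≥0∞) {x y : V} {n : ℕ}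
    (h : G.dist x y ≤ n) : F y ≤ (ballSum G)^[n] F x := by
  obtain ⟨w, hw⟩ := hG.exists_walk_length_eq_dist x y
  exact (le_iterate_ballSum_of_walk F w).trans (iterate_ballSum_mono G F x (hw.trans_le h))

/-- Spread a unit mass from a point `y` of `s`: after `n` iterations the value is at least 1 all
over `s`, while the total is at most `(1 + k) ^ n`. -/
theorem encard_le_of_dist_le {G : SimpleGraph V} (hG : G.Connected) {k : ℕ}
    (hk : ∀ x : V, (G.neighborSet x).encard ≤ (k : ℕ∞)) {n : ℕ} {s : Set V}
    (hs : ∀ x ∈ s, ∀ y ∈ s, G.dist x y ≤ n) : s.encard ≤ ((1 + k) ^ n : ℕ) := by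
  classical
  rcases s.eq_empty_or_nonempty with rfl | ⟨y, hy⟩
  · simp
  have h : ∑' _ : s, (1 : ℝ≥0∞) ≤ (1 + k) ^ n * ∑' x, Pi.single y (1 : ℝ≥0∞) x := by
    refine le_trans ?_ (tsum_iterate_ballSum_le hk n _)
    rw [tsum_subtype s (fun _ => (1 : ℝ≥0∞))]
    refine ENNReal.tsum_le_tsum fun x => Set.indicator_apply_le fun hx => ?_
    simpa using le_iterate_ballSum hG (Pi.single y (1 : ℝ≥0∞)) (hs x hx y hy)
  rw [ENNReal.tsum_set_const, tsum_pi_single, mul_one, mul_one] at h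
  rw [← ENat.toENNReal_le]
  exact_mod_cast h

end NeighbourSum

/-! ### Dirichlet sums under coarse maps -/

section Dirichlet

theorem enorm_sub_rpow_le {p : ℝ} (hp : 1 < p) (a b c : ℝ) :
    ‖a - c‖ₑ ^ p ≤ 2 ^ (p - 1) * (‖a - b‖ₑ ^ p + ‖b - c‖ₑ ^ p) := by
  refine le_trans ?_ (ENNReal.rpow_add_le_mul_rpow_add_rpow _ _ hp.le)
  gcongr
  rw [← sub_add_sub_cancel a b c]
  exact enorm_add_le _ _

theorem one_le_two_rpow {p : ℝ} (hp : 1 < p) : (1 : ℝ≥0∞) ≤ 2 ^ (p - 1) :=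
  ENNReal.one_le_rpow (by norm_num) (by linarith)

theorem two_rpow_ne_top {p : ℝ} (hp : 1 < p) : (2 : ℝ≥0∞) ^ (p - 1) ≠ ∞ :=
  ENNReal.rpow_ne_top_of_nonneg (by linarith) (by simp)

/-- Each edge of the walk costs one convexity factor `2 ^ (p - 1)` and one neighbour summation. -/
theorem enorm_sub_rpow_le_iterate_of_walk {G : SimpleGraph V} {p : ℝ} (hp : 1 < p) (f : V → ℝ)
    {x y : V} (w : G.Walk x y) :
    ‖f y - f x‖ₑ ^ p ≤ (2 ^ (p - 1)) ^ w.length * (ballSum G)^[w.length] (gradPow G p f) x := by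
  induction w with
  | nil => simp [ENNReal.zero_rpow_of_pos (zero_lt_one.trans hp)]
  | @cons x z y h w ih =>
    have hz : ‖f z - f x‖ₑ ^ p ≤ gradPow G p f x :=
      le_tsum_neighborSet (fun z => ‖f z - f x‖ₑ ^ p) h
    calc ‖f y - f x‖ₑ ^ p ≤ 2 ^ (p - 1) * (‖f y - f z‖ₑ ^ p + ‖f z - f x‖ₑ ^ p) :=
          enorm_sub_rpow_le hp _ _ _
      _ ≤ 2 ^ (p - 1) * ((2 ^ (p - 1)) ^ w.length * (ballSum G)^[w.length] (gradPow G p f) z +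
            (2 ^ (p - 1)) ^ w.length * gradPow G p f x) := by
          gcongr
          exact hz.trans (le_mul_of_one_le_left' (one_le_pow₀ (one_le_two_rpow hp)))
      _ = (2 ^ (p - 1)) ^ (w.length + 1) *
            (gradPow G p f x + (ballSum G)^[w.length] (gradPow G p f) z) := by ring
      _ ≤ _ := by
          exact mul_le_mul_right (add_le_iterate_ballSum_succ _ _ h) _

theorem enorm_sub_rpow_le_iterate {G : SimpleGraph V} (hG : G.Connected) {p : ℝ} (hp : 1 < p)
    (f : V → ℝ) {x y : V} {n : ℕ} (h : G.dist x y ≤ n) :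
    ‖f y - f x‖ₑ ^ p ≤ (2 ^ (p - 1)) ^ n * (ballSum G)^[n] (gradPow G p f) x := by
  obtain ⟨w, hw⟩ := hG.exists_walk_length_eq_dist x y
  refine (enorm_sub_rpow_le_iterate_of_walk hp f w).trans ?_
  gcongr
  · exact one_le_two_rpow hp
  · exact hw.trans_le h
  · exact iterate_ballSum_mono G _ x (hw.trans_le h)

theorem tsum_comp_le {φ : V → W} {K : ℕ} (hφ : ∀ w, (φ ⁻¹' {w}).encard ≤ (K : ℕ∞))
    (F : W → ℝ≥0∞) : ∑' x, F (φ x) ≤ K * ∑' w, F w := by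
  rw [← (Equiv.sigmaFiberEquiv φ).tsum_eq, ENNReal.tsum_sigma', ← ENNReal.tsum_mul_left]
  refine ENNReal.tsum_le_tsum fun w => ?_
  have : ∀ x : {x // φ x = w}, F (φ (Equiv.sigmaFiberEquiv φ ⟨w, x⟩)) = F w := fun x =>
    congrArg F x.2
  simp only [this]
  refine (ENNReal.tsum_set_const (φ ⁻¹' {w}) (F w)).trans_le ?_
  gcongr
  exact_mod_cast ENat.toENNReal_le.2 (hφ w)

/-- A map between graphs that moves adjacent vertices a bounded distance apart and whose fibres
have bounded diameter. -/
def IsCoarse (G : SimpleGraph V) (H : SimpleGraph W) (φ : V → W) : Prop :=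
  ∃ n : ℕ, (∀ x y, G.Adj x y → H.dist (φ x) (φ y) ≤ n) ∧ ∀ x y, φ x = φ y → G.dist x y ≤ n

variable {G : SimpleGraph V} {H : SimpleGraph W} {φ : V → W} {p : ℝ}

theorem IsCoarse.exists_encard_fiber_le (hφ : IsCoarse G H φ) (hG : G.Connected)
    (hGd : BoundedDegree G) : ∃ K : ℕ, ∀ w, (φ ⁻¹' {w}).encard ≤ (K : ℕ∞) := by
  obtain ⟨n, -, hn⟩ := hφ
  obtain ⟨k, hk⟩ := hGd
  exact ⟨(1 + k) ^ n, fun w => encard_le_of_dist_le hG hk fun x hx y hy =>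
    hn x y (hx.trans hy.symm)⟩

/-- An edge of `G` maps to a pair at distance at most `n`, controlled by gradient mass near `φ x`.
Each vertex of `H` is hit at most `K` times, so summing over `x` loses only constants. -/
theorem IsCoarse.exists_dirichletSum_comp_le (hφ : IsCoarse G H φ) (hG : G.Connected)
    (hGd : BoundedDegree G) (hH : H.Connected) (hHd : BoundedDegree H) (hp : 1 < p) :
    ∃ C : ℝ≥0∞, C ≠ ∞ ∧ ∀ f : W → ℝ, dirichletSum G p (f ∘ φ) ≤ C * dirichletSum H p f := by
  obtain ⟨K, hK⟩ := hφ.exists_encard_fiber_le hG hGd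
  obtain ⟨n, hn, -⟩ := hφ
  obtain ⟨k, hk⟩ := hGd
  obtain ⟨l, hl⟩ := hHd
  refine ⟨k * ((2 ^ (p - 1)) ^ n * (K * (1 + l) ^ n)), ?_, fun f => ?_⟩
  · have := two_rpow_ne_top hp
    finiteness
  calc dirichletSum G p (f ∘ φ)
      ≤ ∑' x, ∑' _ : G.neighborSet x,
          (2 ^ (p - 1)) ^ n * (ballSum H)^[n] (gradPow H p f) (φ x) :=
        ENNReal.tsum_le_tsum fun x => ENNReal.tsum_le_tsum fun y =>
          enorm_sub_rpow_le_iterate hH hp f (hn x y y.2)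
    _ ≤ ∑' x, k * ((2 ^ (p - 1)) ^ n * (ballSum H)^[n] (gradPow H p f) (φ x)) :=
        ENNReal.tsum_le_tsum fun x => tsum_neighborSet_const_le hk _ x
    _ = k * ((2 ^ (p - 1)) ^ n * ∑' x, (ballSum H)^[n] (gradPow H p f) (φ x)) := by
        rw [ENNReal.tsum_mul_left, ENNReal.tsum_mul_left]
    _ ≤ k * ((2 ^ (p - 1)) ^ n * (K * ((1 + l) ^ n * ∑' w, gradPow H p f w))) := by
        gcongr
        refine (tsum_comp_le hK _).trans ?_
        gcongr
        exact tsum_iterate_ballSum_le hl _ _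
    _ = _ := by
        rw [dirichletSum]
        ring

theorem exists_tsum_sub_le (hG : G.Connected) (hGd : BoundedDegree G) (hp : 1 < p) {θ : V → V}
    {n : ℕ} (hθ : ∀ x, G.dist x (θ x) ≤ n) :
    ∃ C : ℝ≥0∞, C ≠ ∞ ∧ ∀ f : V → ℝ, ∑' x, ‖f (θ x) - f x‖ₑ ^ p ≤ C * dirichletSum G p f := by
  obtain ⟨k, hk⟩ := hGd
  refine ⟨(2 ^ (p - 1)) ^ n * (1 + k) ^ n, ?_, fun f => ?_⟩
  · have := two_rpow_ne_top hp
    finiteness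
  calc ∑' x, ‖f (θ x) - f x‖ₑ ^ p
      ≤ ∑' x, (2 ^ (p - 1)) ^ n * (ballSum G)^[n] (gradPow G p f) x :=
        ENNReal.tsum_le_tsum fun x => enorm_sub_rpow_le_iterate hG hp f (hθ x)
    _ ≤ (2 ^ (p - 1)) ^ n * ((1 + k) ^ n * ∑' x, gradPow G p f x) := by
        rw [ENNReal.tsum_mul_left]
        gcongr
        exact tsum_iterate_ballSum_le hk _ _
    _ = _ := by rw [mul_assoc, dirichletSum]

/-- Change of base point in the Dirichlet norm. -/
theorem exists_enorm_rpow_le (hG : G.Connected) (hGd : BoundedDegree G) (hp : 1 < p) (o x : V) :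
    ∃ C : ℝ≥0∞, C ≠ ∞ ∧ ∀ f : V → ℝ, ‖f x‖ₑ ^ p ≤ C * (dirichletSum G p f + ‖f o‖ₑ ^ p) := by
  obtain ⟨k, hk⟩ := hGd
  set n := G.dist o x
  -- Lets the constant of the Dirichlet term also serve for the base point term.
  have h1 : (1 : ℝ≥0∞) ≤ (2 ^ (p - 1)) ^ n * (1 + k) ^ n :=
    one_le_mul_of_one_le_of_one_le (one_le_pow₀ (one_le_two_rpow hp))
      (one_le_pow₀ le_self_add)
  refine ⟨2 ^ (p - 1) * ((2 ^ (p - 1)) ^ n * (1 + k) ^ n), ?_, fun f => ?_⟩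
  · have := two_rpow_ne_top hp
    finiteness
  have h2 : ‖f x - f o‖ₑ ^ p ≤ (2 ^ (p - 1)) ^ n * (1 + k) ^ n * dirichletSum G p f := by
    refine (enorm_sub_rpow_le_iterate hG hp f le_rfl).trans ?_
    rw [mul_assoc]
    gcongr
    exact (ENNReal.le_tsum o).trans (tsum_iterate_ballSum_le hk _ _)
  calc ‖f x‖ₑ ^ p ≤ 2 ^ (p - 1) * (‖f x - f o‖ₑ ^ p + ‖f o‖ₑ ^ p) := by
        simpa using enorm_sub_rpow_le hp (f x) (f o) 0
    _ ≤ 2 ^ (p - 1) * ((2 ^ (p - 1)) ^ n * (1 + k) ^ n * dirichletSum G p f +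
          (2 ^ (p - 1)) ^ n * (1 + k) ^ n * ‖f o‖ₑ ^ p) := by
        gcongr
        exact le_mul_of_one_le_left' h1
    _ = _ := by ring

theorem exists_dirichletSum_le_tsum (hGd : BoundedDegree G) (hp : 1 < p) :
    ∃ C : ℝ≥0∞, C ≠ ∞ ∧ ∀ f : V → ℝ, dirichletSum G p f ≤ C * ∑' x, ‖f x‖ₑ ^ p := by
  obtain ⟨k, hk⟩ := hGd
  refine ⟨2 ^ (p - 1) * (k + k), ?_, fun f => ?_⟩
  · have := two_rpow_ne_top hp
    finiteness
  calc dirichletSum G p f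
      ≤ ∑' x, ∑' y : G.neighborSet x, 2 ^ (p - 1) * (‖f y‖ₑ ^ p + ‖f x‖ₑ ^ p) :=
        ENNReal.tsum_le_tsum fun x => ENNReal.tsum_le_tsum fun y => by
          simpa using enorm_sub_rpow_le hp (f y) 0 (f x)
    _ = 2 ^ (p - 1) * (∑' x, ∑' y : G.neighborSet x, ‖f y‖ₑ ^ p +
          ∑' x, ∑' _ : G.neighborSet x, ‖f x‖ₑ ^ p) := by
        simp only [ENNReal.tsum_mul_left, ENNReal.tsum_add]
    _ ≤ 2 ^ (p - 1) * (k * ∑' x, ‖f x‖ₑ ^ p + ∑' x, k * ‖f x‖ₑ ^ p) := by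
        gcongr with x
        · exact tsum_tsum_neighborSet_le hk fun x => ‖f x‖ₑ ^ p
        · exact tsum_neighborSet_const_le hk _ x
    _ = _ := by
        rw [ENNReal.tsum_mul_left]
        ring

end Dirichlet

/-! ### The closure of the finitely supported functions -/

section Closure

variable {G : SimpleGraph V} {H : SimpleGraph W} {φ : V → W} {p : ℝ}

theorem inClosureFinSupp_iff (hp : 1 < p) {o : V} {f : V → ℝ} :
    InClosureFinSupp G p o f ↔ IsDirichletFinite G p f ∧
      ∀ ε : ℝ≥0∞, 0 < ε → ∃ g : V → ℝ, (Function.support g).Finite ∧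
        dirichletSum G p (f - g) + ‖(f - g) o‖ₑ ^ p < ε := by
  have hp0 : 0 < p := zero_lt_one.trans hp
  refine and_congr_right fun _ => ⟨fun h ε hε => ?_, fun h ε hε => ?_⟩
  · obtain ⟨g, hg, hlt⟩ := h (ε ^ (1 / p)) (ENNReal.rpow_pos_of_nonneg hε (by positivity))
    exact ⟨g, hg, (ENNReal.rpow_lt_rpow_iff (by positivity)).1 hlt⟩
  · obtain ⟨g, hg, hlt⟩ := h (ε ^ p) (ENNReal.rpow_pos_of_nonneg hε hp0.le)
    refine ⟨g, hg, ?_⟩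
    have := ENNReal.rpow_lt_rpow hlt (show 0 < 1 / p by positivity)
    rwa [← ENNReal.rpow_mul, mul_one_div_cancel hp0.ne', ENNReal.rpow_one] at this

theorem exists_pos_mul_lt {C ε : ℝ≥0∞} (hC : C ≠ ∞) (hε : 0 < ε) :
    ∃ δ : ℝ≥0∞, 0 < δ ∧ ∀ a < δ, C * a < ε := by
  rcases eq_or_ne C 0 with rfl | hC0
  · exact ⟨1, one_pos, fun a _ => by simpa using hε⟩
  · exact ⟨ε / C, ENNReal.div_pos hε.ne' hC, fun a ha => by
      rw [mul_comm]; exact (ENNReal.lt_div_iff_mul_lt (.inl hC0) (.inl hC)).1 ha⟩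

/-- Truncations to finite sets converge in `ℓ^p`, and by bounded degree the `ℓ^p` norm dominates the
Dirichlet norm. -/
theorem inClosureFinSupp_of_tsum_lt_top (hGd : BoundedDegree G) (hp : 1 < p) (o : V) {f : V → ℝ}
    (hf : ∑' x, ‖f x‖ₑ ^ p < ∞) : InClosureFinSupp G p o f := by
  have hp0 : 0 < p := zero_lt_one.trans hp
  obtain ⟨C, hC, hle⟩ := exists_dirichletSum_le_tsum hGd hp
  refine (inClosureFinSupp_iff hp).2
    ⟨(hle f).trans_lt (ENNReal.mul_lt_top hC.lt_top hf), fun ε hε => ?_⟩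
  -- `C` pays for the Dirichlet sum, `1` for the value at `o`.
  obtain ⟨δ, hδ, hlt⟩ := exists_pos_mul_lt (C := C + 1) (by finiteness) hε
  obtain ⟨s, hs⟩ := ((ENNReal.tendsto_tsum_compl_atTop_zero hf.ne).eventually_lt_const hδ).exists
  refine ⟨(s : Set V).indicator f, s.finite_toSet.subset Set.support_indicator_subset, ?_⟩
  have hsub : f - (s : Set V).indicator f = (s : Set V)ᶜ.indicator f := by
    rw [Set.indicator_compl]
  have hsum : ∑' x, ‖(s : Set V)ᶜ.indicator f x‖ₑ ^ p < δ := by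
    convert hs using 1
    refine Eq.trans (tsum_congr fun x => ?_)
      (tsum_subtype (s : Set V)ᶜ (fun x => ‖f x‖ₑ ^ p)).symm
    by_cases hx : x ∈ (s : Set V)ᶜ
    · simp only [Set.indicator_of_mem hx]
    · simp only [Set.indicator_of_notMem hx, enorm_zero, ENNReal.zero_rpow_of_pos hp0]
  rw [hsub]
  refine lt_of_le_of_lt ?_ (hlt _ hsum)
  rw [add_mul, one_mul]
  exact add_le_add (hle _) (ENNReal.le_tsum (f := fun x => ‖(s : Set V)ᶜ.indicator f x‖ₑ ^ p) o)

theorem IsCoarse.inClosureFinSupp_comp (hφ : IsCoarse G H φ) (hG : G.Connected)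
    (hGd : BoundedDegree G) (hH : H.Connected) (hHd : BoundedDegree H) (hp : 1 < p) {oG : V}
    {oH : W} {f : W → ℝ} (hf : InClosureFinSupp H p oH f) :
    InClosureFinSupp G p oG (f ∘ φ) := by
  obtain ⟨hfin, happ⟩ := (inClosureFinSupp_iff hp).1 hf
  obtain ⟨K, hK⟩ := hφ.exists_encard_fiber_le hG hGd
  obtain ⟨C, hC, hle⟩ := hφ.exists_dirichletSum_comp_le hG hGd hH hHd hp
  -- Composition moves the base point to `φ oG`, which need not be `oH`.
  obtain ⟨D, hD, hle'⟩ := exists_enorm_rpow_le hH hHd hp oH (φ oG)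
  refine (inClosureFinSupp_iff hp).2
    ⟨(hle f).trans_lt (ENNReal.mul_lt_top hC.lt_top hfin), fun ε hε => ?_⟩
  obtain ⟨δ, hδ, hlt⟩ := exists_pos_mul_lt (C := C + D) (by finiteness) hε
  obtain ⟨g, hg, hgδ⟩ := happ δ hδ
  refine ⟨g ∘ φ, ?_, lt_of_le_of_lt ?_ (hlt _ hgδ)⟩
  · rw [Function.support_comp_eq_preimage]
    exact hg.preimage' fun w _ => Set.encard_lt_top_iff.1 ((hK w).trans_lt (by simp))
  · rw [add_mul]
    exact add_le_add ((hle (f - g)).trans (by gcongr; exact le_self_add)) (hle' (f - g))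

end Closure

/-! ### Induced maps of spectra and harmonic boundaries -/

section Pullback

variable {G : SimpleGraph V} {H : SimpleGraph W} {φ : V → W} {p : ℝ}

/-- Composition with a coarse map, as a homomorphism `BD_p(H) → BD_p(G)`. -/
noncomputable def pullback (hp : 1 < p) (hφ : IsCoarse G H φ) (hG : G.Connected)
    (hGd : BoundedDegree G) (hH : H.Connected) (hHd : BoundedDegree H) :
    BD H p hp →ₙₐ[ℝ] BD G p hp where
  toFun f := ⟨f.1 ∘ φ, by
    obtain ⟨C, hC, hle⟩ := hφ.exists_dirichletSum_comp_le hG hGd hH hHd hp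
    obtain ⟨hf, M, hM⟩ := f.2
    exact ⟨(hle _).trans_lt (ENNReal.mul_lt_top hC.lt_top hf), M, fun x => hM (φ x)⟩⟩
  map_smul' _ _ := rfl
  map_zero' := rfl
  map_add' _ _ := rfl
  map_mul' _ _ := rfl

/-- Characters are not assumed unital. Nonvanishing at 1 survives pullback, since constants pull
back to constants, so induced characters are again nonzero. -/
theorem Sp.map_one_ne_zero {hp : 1 < p} (τ : Sp G p hp) : τ.1 1 ≠ 0 := fun h =>
  τ.2 <| by
    ext f
    simpa [h] using map_mul τ.1 1 f

/-- The map of spectra induced by a coarse map. -/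
noncomputable def spMap (hp : 1 < p) (hφ : IsCoarse G H φ) (hG : G.Connected)
    (hGd : BoundedDegree G) (hH : H.Connected) (hHd : BoundedDegree H) (τ : Sp G p hp) :
    Sp H p hp :=
  ⟨τ.1.comp (pullback hp hφ hG hGd hH hHd), fun h =>
    τ.map_one_ne_zero (DFunLike.congr_fun h 1)⟩

theorem continuous_spMap (hp : 1 < p) (hφ : IsCoarse G H φ) (hG : G.Connected)
    (hGd : BoundedDegree G) (hH : H.Connected) (hHd : BoundedDegree H) :
    Continuous (spMap hp hφ hG hGd hH hHd) :=
  continuous_induced_rng.2 <| continuous_pi fun f =>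
    (continuous_apply (pullback hp hφ hG hGd hH hHd f)).comp continuous_induced_dom

/-- Evaluation at a vertex does not kill all finitely supported functions, so the harmonic
boundary consists of all characters vanishing on the closure of those. -/
theorem mem_harmonicBoundary_iff {hp : 1 < p} (hGd : BoundedDegree G) {o : V} {τ : Sp G p hp} :
    τ ∈ harmonicBoundary G p hp o ↔
      ∀ f : BD G p hp, InClosureFinSupp G p o f.1 → τ.1 f = 0 := by
  classical
  refine ⟨fun h => h.2, fun h => ⟨?_, h⟩⟩
  rintro ⟨x, rfl⟩
  have hcl : InClosureFinSupp G p o (Pi.single x 1) := by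
    refine inClosureFinSupp_of_tsum_lt_top hGd hp o ?_
    rw [tsum_eq_single x fun y hy => by
      simp [hy, ENNReal.zero_rpow_of_pos (zero_lt_one.trans hp)]]
    simp
  have hbd : (Pi.single x 1 : V → ℝ) ∈ BD G p hp := by
    refine ⟨hcl.1, 1, fun y => ?_⟩
    rcases eq_or_ne y x with rfl | hy <;> simp [*]
  have h0 := h ⟨_, hbd⟩ hcl
  simp [evalChar] at h0

theorem spMap_mem_harmonicBoundary (hp : 1 < p) (hφ : IsCoarse G H φ) (hG : G.Connected)
    (hGd : BoundedDegree G) (hH : H.Connected) (hHd : BoundedDegree H) {oG : V} {oH : W}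
    {τ : Sp G p hp} (hτ : τ ∈ harmonicBoundary G p hp oG) :
    spMap hp hφ hG hGd hH hHd τ ∈ harmonicBoundary H p hp oH :=
  (mem_harmonicBoundary_iff hHd).2 fun _ hf =>
    hτ.2 _ (hφ.inClosureFinSupp_comp hG hGd hH hHd hp hf)

theorem spMap_spMap {ψ : W → V} (hp : 1 < p) (hφ : IsCoarse G H φ) (hψ : IsCoarse H G ψ)
    (hG : G.Connected) (hGd : BoundedDegree G) (hH : H.Connected) (hHd : BoundedDegree H) {n : ℕ}
    (hn : ∀ x, G.dist x (ψ (φ x)) ≤ n) {oG : V} {τ : Sp G p hp}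
    (hτ : τ ∈ harmonicBoundary G p hp oG) :
    spMap hp hψ hH hHd hG hGd (spMap hp hφ hG hGd hH hHd τ) = τ := by
  refine Subtype.ext (NonUnitalAlgHom.ext fun f => ?_)
  obtain ⟨C, hC, hle⟩ := exists_tsum_sub_le (θ := ψ ∘ φ) hG hGd hp hn
  -- The difference is in `ℓ^p`, so `τ` kills it and cannot distinguish `f ∘ ψ ∘ φ` from `f`.
  have hcl := hτ.2 (pullback hp hφ hG hGd hH hHd (pullback hp hψ hH hHd hG hGd f) - f)
    (inClosureFinSupp_of_tsum_lt_top hGd hp oG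
      ((hle f.1).trans_lt (ENNReal.mul_lt_top hC.lt_top f.2.1)))
  rw [map_sub, sub_eq_zero] at hcl
  exact hcl

/-- Mutually inverse (up to bounded distance) coarse maps induce a homeomorphism of harmonic
boundaries. -/
noncomputable def harmonicBoundaryHomeomorph {ψ : W → V} (hp : 1 < p) (hφ : IsCoarse G H φ)
    (hψ : IsCoarse H G ψ) (hG : G.Connected) (hGd : BoundedDegree G) (hH : H.Connected)
    (hHd : BoundedDegree H) {n : ℕ} (hn : ∀ x, G.dist x (ψ (φ x)) ≤ n)
    (hn' : ∀ y, H.dist y (φ (ψ y)) ≤ n) (oG : V) (oH : W) :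
    harmonicBoundary G p hp oG ≃ₜ harmonicBoundary H p hp oH where
  toFun τ := ⟨_, spMap_mem_harmonicBoundary hp hφ hG hGd hH hHd τ.2⟩
  invFun τ := ⟨_, spMap_mem_harmonicBoundary hp hψ hH hHd hG hGd τ.2⟩
  left_inv τ := Subtype.ext (spMap_spMap hp hφ hψ hG hGd hH hHd hn τ.2)
  right_inv τ := Subtype.ext (spMap_spMap hp hψ hφ hH hHd hG hGd hn' τ.2)
  continuous_toFun :=
    ((continuous_spMap hp hφ hG hGd hH hHd).comp continuous_subtype_val).subtype_mk _
  continuous_invFun :=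
    ((continuous_spMap hp hψ hH hHd hG hGd).comp continuous_subtype_val).subtype_mk _

end Pullback

/-! ### Rough inverses of rough isometries -/

theorem IsRoughIsometry.exists_coarse_inverse {G : SimpleGraph V} {H : SimpleGraph W} {φ : V → W}
    (hH : H.Connected) (hφ : IsRoughIsometry G H φ) :
    ∃ ψ : W → V, IsCoarse G H φ ∧ IsCoarse H G ψ ∧
      ∃ n : ℕ, (∀ x, G.dist x (ψ (φ x)) ≤ n) ∧ ∀ y, H.dist y (φ (ψ y)) ≤ n := by
  obtain ⟨⟨a, b, ha, hb, hab⟩, c, hc, hsurj⟩ := hφ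
  choose ψ hψ using hsurj
  have ha0 : 0 < a := zero_lt_one.trans_le ha
  have hlow : ∀ x y, (G.dist x y : ℝ) ≤ a * (H.dist (φ x) (φ y) + b) := fun x y => by
    have h := (hab x y).1
    rw [one_div, sub_le_iff_le_add, inv_mul_le_iff₀ ha0] at h
    exact h
  have htri : ∀ y y', (H.dist y y' : ℝ) ≤ 2 * c + H.dist (φ (ψ y)) (φ (ψ y')) := fun y y' => by
    have h1 : (H.dist y y' : ℝ) ≤ H.dist y (φ (ψ y)) + H.dist (φ (ψ y)) y' := by
      exact_mod_cast hH.dist_triangle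
    have h2 : (H.dist (φ (ψ y)) y' : ℝ) ≤
        H.dist (φ (ψ y)) (φ (ψ y')) + H.dist (φ (ψ y')) y' := by
      exact_mod_cast hH.dist_triangle
    have h3 := hψ y
    rw [SimpleGraph.dist_comm] at h3
    linarith [hψ y']
  have htri' : ∀ y y', (H.dist (φ (ψ y)) (φ (ψ y')) : ℝ) ≤ 2 * c + H.dist y y' := fun y y' => by
    have h1 : (H.dist (φ (ψ y)) (φ (ψ y')) : ℝ) ≤ H.dist (φ (ψ y)) y + H.dist y (φ (ψ y')) := by
      exact_mod_cast hH.dist_triangle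
    have h2 : (H.dist y (φ (ψ y')) : ℝ) ≤ H.dist y y' + H.dist y' (φ (ψ y')) := by
      exact_mod_cast hH.dist_triangle
    have h3 := hψ y'
    rw [SimpleGraph.dist_comm] at h3
    linarith [hψ y]
  have key : ∀ {m : ℕ} {r : ℝ}, (m : ℝ) ≤ r → ∀ {s : ℝ}, r ≤ s → m ≤ ⌈s⌉₊ := fun h _ h' =>
    Nat.cast_le.1 ((h.trans h').trans (Nat.le_ceil _))
  -- Each maximum joins two bounds. For `φ`: edges `a + b`, fibres `a * b`. For `ψ`: edges `a * (2 *
  -- c + 1 + b)`, as their images under `φ ∘ ψ` are within `2 * c + 1`; fibres `2 * c`.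
  -- Displacements: `a * (c + b)` in `G`, `c` in `H`.
  refine ⟨ψ, ⟨⌈max (a + b) (a * b)⌉₊, fun x y h => ?_, fun x y h => ?_⟩,
    ⟨⌈max (a * (2 * c + 1 + b)) (2 * c)⌉₊, fun x y h => ?_, fun x y h => ?_⟩,
    ⌈max (a * (c + b)) c⌉₊, fun x => ?_, fun y => ?_⟩
  · refine key (hab x y).2 (le_trans (le_of_eq ?_) (le_max_left _ _))
    rw [SimpleGraph.dist_eq_one_iff_adj.2 h, Nat.cast_one, mul_one]
  · refine key (hlow x y) (le_trans (le_of_eq ?_) (le_max_right _ _))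
    rw [h, SimpleGraph.dist_self, Nat.cast_zero, zero_add]
  · refine key (hlow _ _) (le_trans ?_ (le_max_left _ _))
    gcongr
    have := htri' x y
    rwa [SimpleGraph.dist_eq_one_iff_adj.2 h, Nat.cast_one] at this
  · refine key (htri x y) (le_trans (le_of_eq ?_) (le_max_right _ _))
    rw [h, SimpleGraph.dist_self, Nat.cast_zero, add_zero]
  · refine key (hlow _ _) (le_trans ?_ (le_max_left _ _))
    gcongr
    rw [SimpleGraph.dist_comm]
    exact (hψ _).le
  · rw [SimpleGraph.dist_comm]
    exact key (hψ y).le (le_max_right _ _)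

end PHarm

theorem theorem2p6 {V : Type*} {W : Type*} [Countable V] [Infinite V] [Countable W] [Infinite W]
    (G : SimpleGraph V) (H : SimpleGraph W)
    (hG : G.Connected) (hH : H.Connected)
    (hGdeg : PHarm.BoundedDegree G) (hHdeg : PHarm.BoundedDegree H)
    (p : ℝ) (hp : 1 < p) (oG : V) (oH : W)
    (hφ : ∃ φ : V → W, PHarm.IsRoughIsometry G H φ) :
    Nonempty (PHarm.harmonicBoundary G p hp oG ≃ₜ PHarm.harmonicBoundary H p hp oH) := by
  obtain ⟨φ, hφ⟩ := hφ
  obtain ⟨ψ, hcφ, hcψ, n, hn, hn'⟩ := hφ.exists_coarse_inverse hH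
  exact ⟨PHarm.harmonicBoundaryHomeomorph hp hcφ hcψ hG hGdeg hH hHdeg hn hn' oG oH⟩
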